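/- Let $d, D, b \ge 2$ and $n \ge 1$ be integers, with $n \ge 2$ if $d = 2$. Call $d$ and $D$ commensurable if $\log_d D$ is rational. A best $n$-digit floating point approximation in radix $d$ to a real number $r > 0$ is a number $m \times d^q$ with integers $m, q$ such that $d^{n-1} \le m < d^n$ and $r = (m+\varepsilon)\times d^q$, where $|\varepsilon| \le 1/2$, and $\varepsilon \ge -1/(2d)$ if $m = d^{n-1}$; $m$ is its significand. If $r$ is halfway between two neighbouring $n$-digit numbers, either of the two significands counts as correct, or, in the round-to-even version, only the even one if exactly one is even (the statement below holds in both versions). Clinger's problem is the following task for a machine: given a word that consists of the radix-$D$ digits of a positive integer $f$, the sign of an integer $e$, the radix-$b$ digits of $|e|$, and a stop marker, determine the significand of the best $n$-digit approximation in radix $d$ to $f \times D^e$. Each of the two digit strings is presented in a fixed order, least or most significant digit first (the statement holds for each choice); leading zeros are allowed, and the empty string of digits denotes $0$. A machine is equipped with a function that decodes its final state into a number. A deterministic finite automaton (DFA) solves the problem if it accepts every such word and the state in which it ends decodes to a correct significand; a (nondeterministic) push-down automaton (PDA) solves it if every such word has a computation that consumes the word and ends in an accepting state, and the final state of every such computation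 decodes to a correct significand. Then Clinger's problem can be solved by a PDA if and only if $d$ and $D$ are commensurable, and it can be solved by a DFA if and only if $d$ and $D$ are commensurable. -/

import Mathlib

namespace Clinger

/-! ### Machines with output -/

/-- A (nondeterministic) push-down automaton with input alphabet `α`, states `Q` and stack
alphabet `Γ`. In `trans q a X`, `a = none` stands for an ε-move; a member `(p, γ)` means: go to
state `p` and replace the top stack symbol `X` by the string `γ` (leftmost symbol on top). -/
structure PDA (α Q Γ : Type) where
  trans : Q → Option α → Γ → Finset (Q × List Γ)
  start : Q
  startSymbol : Γ
  accept : Set Q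

namespace PDA

variable {α Q Γ : Type}

/-- One move between instantaneous descriptions (state, unread input, stack with top first). -/
inductive Step (M : PDA α Q Γ) : Q × List α × List Γ → Q × List α × List Γ → Prop
  | read (q p : Q) (a : α) (w : List α) (X : Γ) (γ β : List Γ)
      (h : (p, γ) ∈ M.trans q (some a) X) : Step M (q, a :: w, X :: β) (p, w, γ ++ β)
  | eps (q p : Q) (w : List α) (X : Γ) (γ β : List Γ)
      (h : (p, γ) ∈ M.trans q none X) : Step M (q, w, X :: β) (p, w, γ ++ β)

/-- Some computation of `M` consumes the whole word `w` and ends in the accepting state `q`. -/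
def AcceptsIn (M : PDA α Q Γ) (w : List α) (q : Q) : Prop :=
  q ∈ M.accept ∧ ∃ β : List Γ,
    Relation.ReflTransGen M.Step (M.start, w, [M.startSymbol]) (q, [], β)

end PDA

/-- A computational problem over the alphabet `α`: a set of instances, each consisting of an
input word and the set of the correct answers for it. Words that occur in no instance are not
legal inputs, and nothing is required of a machine on them. -/
abbrev Problem (α : Type) : Type := Set (List α × Set ℕ)

/-- A problem is solved by a PDA if for some PDA with finitely many states and stack symbols and
some function `out` decoding its final state, on each instance there is an accepting computation
and every accepting computation yields a correct answer. -/
def SolvableByPDA {α : Type} (P : Problem α) : Prop :=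
  ∃ (Q Γ : Type) (_ : Finite Q) (_ : Finite Γ) (M : PDA α Q Γ) (out : Q → ℕ),
    ∀ w S, (w, S) ∈ P →
      (∃ q, M.AcceptsIn w q) ∧ ∀ q, M.AcceptsIn w q → out q ∈ S

/-- A problem is solved by a DFA if for some deterministic finite automaton and some function
`out` decoding its final state, each input is accepted and yields a correct answer. -/
def SolvableByDFA {α : Type} (P : Problem α) : Prop :=
  ∃ (Q : Type) (_ : Finite Q) (M : DFA α Q) (out : Q → ℕ),
    ∀ w S, (w, S) ∈ P → w ∈ M.accepts ∧ out (M.eval w) ∈ S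

/-! ### Floating point approximation -/

/-- The radices `d` and `D` are commensurable if `log_d D` is rational. -/
def Commensurable (d D : ℕ) : Prop := ¬ Irrational (Real.logb d D)

/-- `m` is the significand of a best `n`-digit floating point approximation `m × d ^ q` in
radix `d` to the real number `r`. -/
def IsBestSignificand (d n : ℕ) (r : ℝ) (m : ℕ) : Prop :=
  d ^ (n - 1) ≤ m ∧ m < d ^ n ∧ ∃ (q : ℤ) (ε : ℝ),
    r = ((m : ℝ) + ε) * (d : ℝ) ^ q ∧ |ε| ≤ 1 / 2 ∧
      (m = d ^ (n - 1) → -(1 / (2 * (d : ℝ))) ≤ ε)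

/-- What to answer if `r` is halfway between two neighbouring `n`-digit numbers: either of them,
or the one with an even significand (if there is one). -/
inductive TieRule
  | either
  | toEven

/-- `m` is the significand of a best approximation, with ties resolved by the given rule. -/
def IsSignificand : TieRule → (d n : ℕ) → (r : ℝ) → (m : ℕ) → Prop
  | .either, d, n, r, m => IsBestSignificand d n r m
  | .toEven, d, n, r, m => IsBestSignificand d n r m ∧
      (Even m ∨ ∀ m', IsBestSignificand d n r m' → ¬ Even m')

/-! ### Clinger's problem -/

/-- The order in which the digits of a number are presented. -/
inductive DigitOrder
  | leastFirst
  | mostFirst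

/-- The value of a string of radix `b` digits; leading zeros are allowed and the empty string
denotes `0`. -/
def value {b : ℕ} : DigitOrder → List (Fin b) → ℕ
  | .leastFirst, z => Nat.ofDigits b (z.map Fin.val)
  | .mostFirst, z => Nat.ofDigits b (z.reverse.map Fin.val)

/-- The input alphabet: radix `D` digits of the integer `f`, a sign, which separates `f` from the
exponent, radix `b` digits of the absolute value of the exponent, and the stop marker. -/
inductive Letter (D b : ℕ)
  | sig (x : Fin D)
  | plus
  | minus
  | exp (x : Fin b)
  | endMark

/-- The input word: the digits `u`, the sign (`neg = true` for minus), the digits `v`, and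
the stop marker. -/
def encode {D b : ℕ} (u : List (Fin D)) (neg : Bool) (v : List (Fin b)) : List (Letter D b) :=
  u.map Letter.sig ++ (if neg then Letter.minus else Letter.plus) ::
    (v.map Letter.exp ++ [Letter.endMark])

/-- The integer with the given sign and absolute value. -/
def signed (neg : Bool) (k : ℕ) : ℤ := if neg then -(k : ℤ) else (k : ℤ)

/-- Clinger's problem: given the radix `D` digits of a positive integer `f` and the sign and the
radix `b` digits of an integer `e`, find the significand of the best `n`-digit approximation in
radix `d` to `f × D ^ e`. -/
def clingerProblem (d D b n : ℕ) (ordF ordE : DigitOrder) (tie : TieRule) :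
    Problem (Letter D b) :=
  {p | ∃ (u : List (Fin D)) (neg : Bool) (v : List (Fin b)), 0 < value ordF u ∧
    p = (encode u neg v,
      {m | IsSignificand tie d n
        ((value ordF u : ℝ) * (D : ℝ) ^ signed neg (value ordE v)) m})}

end Clinger

namespace Clinger

section Pushdown

variable {P Γ : Type} {R : P → Γ → ℕ → P → List Γ → Prop} {U V : Set (P × Γ × P)}

/-- In the pushdown system whose rules `R p X c p' γ` replace, at cost `c`, the state `p` and the
top symbol `X` by `p'` and `γ`, the relation `Pops R U p γ q n s` says that from state `p` the
string `γ` can be popped completely, arriving in `q`, at total cost `n` and in `s` moves. No symbol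
may be popped in a way that belongs to the set `U` of forbidden triples. -/
inductive Pops (R : P → Γ → ℕ → P → List Γ → Prop) (U : Set (P × Γ × P)) :
    P → List Γ → P → ℕ → ℕ → Prop
  | nil (p : P) : Pops R U p [] p 0 0
  | cons {p p' r q : P} {X : Γ} {γ β : List Γ} {c n₁ n₂ s₁ s₂ : ℕ} (hR : R p X c p' γ)
      (hU : (p, X, r) ∉ U) (h₁ : Pops R U p' γ r n₁ s₁) (h₂ : Pops R U r β q n₂ s₂) :
      Pops R U p (X :: β) q (c + n₁ + n₂) (s₁ + s₂ + 1)

theorem Pops.anti {p q : P} {γ : List Γ} {n s : ℕ} (hVU : V ⊆ U) (h : Pops R U p γ q n s) :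
    Pops R V p γ q n s := by
  induction h with
  | nil p => exact .nil p
  | cons hR hU _ _ ih₁ ih₂ => exact .cons hR (fun h => hU (hVU h)) ih₁ ih₂

theorem Pops.append {p r q : P} {γ β : List Γ} {n n' s s' : ℕ} (h : Pops R U p γ r n s)
    (h' : Pops R U r β q n' s') : Pops R U p (γ ++ β) q (n + n') (s + s') := by
  induction h with
  | nil p => simpa using h'
  | @cons _ _ _ _ _ _ _ c n₁ n₂ s₁ s₂ hR hU h₁ _ _ ih₂ =>
    rw [add_assoc (c + n₁), show s₁ + s₂ + 1 + s' = s₁ + (s₂ + s') + 1 by ring]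
    exact .cons hR hU h₁ (ih₂ h')

theorem Pops.exists_of_append {p q : P} {γ β : List Γ} {n s : ℕ}
    (h : Pops R U p (γ ++ β) q n s) :
    ∃ r n₁ s₁ n₂ s₂, Pops R U p γ r n₁ s₁ ∧ Pops R U r β q n₂ s₂ ∧ n = n₁ + n₂ := by
  induction γ generalizing p n s with
  | nil => exact ⟨p, 0, 0, n, s, .nil p, h, by simp⟩
  | cons X γ ih =>
    cases h with
    | cons hR hU h₁ h₂ =>
      obtain ⟨r, n₁, s₁, n₂, s₂, h₃, h₄, rfl⟩ := ih h₂
      exact ⟨r, _, _, n₂, s₂, .cons hR hU h₁ h₃, h₄, by ring⟩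

/-- Either a computation avoids a given triple, or it can be cut at an occurrence of this triple
into an inner computation and a context, in which the inner one may be replaced. -/
theorem Pops.avoids_or_factors {p q : P} {γ : List Γ} {n s : ℕ} (p₀ : P) (X₀ : Γ) (r₀ : P)
    (h : Pops R U p γ q n s) :
    Pops R (insert (p₀, X₀, r₀) U) p γ q n s ∨
      ∃ a n' s', n = a + n' ∧ s' ≤ s ∧ Pops R U p₀ [X₀] r₀ n' s' ∧
        ∀ m t, Pops R ∅ p₀ [X₀] r₀ m t → ∃ t', Pops R ∅ p γ q (a + m) t' := by
  induction h with
  | nil p => exact .inl (.nil p)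
  | @cons p p' r q X γ β c n₁ n₂ s₁ s₂ hR hU h₁ h₂ ih₁ ih₂ =>
    by_cases ht : (p, X, r) = (p₀, X₀, r₀)
    · simp only [Prod.mk.injEq] at ht
      obtain ⟨rfl, rfl, rfl⟩ := ht
      refine .inr ⟨n₂, c + n₁, s₁ + 1, by ring, by omega, ?_, fun m t hm => ⟨t + s₂, ?_⟩⟩
      · exact .cons hR hU h₁ (.nil r)
      · rw [add_comm n₂ m]
        exact hm.append (h₂.anti (Set.empty_subset _))
    rcases ih₁ with ih₁ | ⟨a, n', s', rfl, hs, hp, hfill⟩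
    · rcases ih₂ with ih₂ | ⟨a, n', s', rfl, hs, hp, hfill⟩
      · refine .inl (.cons hR ?_ ih₁ ih₂)
        simp only [Set.mem_insert_iff, not_or]
        exact ⟨ht, hU⟩
      · refine .inr ⟨c + n₁ + a, n', s', by ring, by omega, hp, fun m t hm => ?_⟩
        obtain ⟨t', ht'⟩ := hfill m t hm
        refine ⟨s₁ + t' + 1, ?_⟩
        rw [add_assoc (c + n₁)]
        exact .cons hR (Set.notMem_empty _) (h₁.anti (Set.empty_subset _)) ht'
    · refine .inr ⟨c + a + n₂, n', s', by ring, by omega, hp, fun m t hm => ?_⟩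
      obtain ⟨t', ht'⟩ := hfill m t hm
      refine ⟨t' + s₂ + 1, ?_⟩
      rw [show c + a + n₂ + m = c + (a + m) + n₂ by ring]
      exact .cons hR (Set.notMem_empty _) ht' (h₂.anti (Set.empty_subset _))

/-- The costs of popping `γ` from `p` to `q` contain an infinite arithmetic progression. -/
def Pumps (R : P → Γ → ℕ → P → List Γ → Prop) (p : P) (γ : List Γ) (q : P) : Prop :=
  ∃ a k, 0 < k ∧ ∀ i, ∃ s, Pops R ∅ p γ q (a + i * k) s

/-- A computation popping one symbol either yields an arithmetic progression of costs, or can be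
replaced by one of the same cost that does not repeat the triple at its root. -/
theorem Pops.pumps_or_exists_rule {p r : P} {X : Γ} {n s : ℕ} (h : Pops R U p [X] r n s) :
    Pumps R p [X] r ∨ ∃ c p' γ n' s', R p X c p' γ ∧
      Pops R (insert (p, X, r) U) p' γ r n' s' ∧ n = c + n' := by
  induction s using Nat.strong_induction_on generalizing n with
  | _ s ih =>
    cases h with
    | @cons _ p' r' _ _ γ _ c n₁ n₂ s₁ s₂ hR hU h₁ h₂ =>
      cases h₂
      rcases h₁.avoids_or_factors p X r with h₃ | ⟨a, n', s', rfl, hs, hp, hfill⟩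
      · exact .inr ⟨c, p', γ, n₁, s₁, hR, h₃, by ring⟩
      · rcases Nat.eq_zero_or_pos (c + a) with h0 | hpos
        · have := ih s' (by omega) hp
          rwa [show c + (a + n') + 0 = n' by omega]
        · refine .inl ⟨n', c + a, hpos, fun i => ?_⟩
          induction i with
          | zero => exact ⟨s', by simpa using hp.anti (Set.empty_subset _)⟩
          | succ i ihi =>
            obtain ⟨t, ht⟩ := ihi
            obtain ⟨t', ht'⟩ := hfill _ t ht
            refine ⟨t' + 0 + 1, ?_⟩
            have := Pops.cons hR (Set.notMem_empty _) ht' (.nil r)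
            convert this using 1
            ring

theorem pumps_of_infinite_of_pumps_singleton
    (H : ∀ p X r, {n | ∃ s, Pops R U p [X] r n s}.Infinite → Pumps R p [X] r) [Finite P]
    (γ : List Γ) (p q : P) (h : {n | ∃ s, Pops R U p γ q n s}.Infinite) : Pumps R p γ q := by
  induction γ generalizing p with
  | nil =>
    refine absurd ((Set.finite_singleton 0).subset ?_) h
    rintro n ⟨s, hs⟩
    cases hs
    rfl
  | cons X γ ih =>
    by_contra hcon
    refine h ?_
    have hsub : {n | ∃ s, Pops R U p (X :: γ) q n s} ⊆ ⋃ r : P,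
        Set.image2 (· + ·) {n | ∃ s, Pops R U p [X] r n s} {n | ∃ s, Pops R U r γ q n s} := by
      rintro n ⟨s, hs⟩
      obtain ⟨r, n₁, s₁, n₂, s₂, h₁, h₂, rfl⟩ :=
        Pops.exists_of_append (γ := [X]) (β := γ) hs
      exact Set.mem_iUnion.2 ⟨r, n₁, ⟨s₁, h₁⟩, n₂, ⟨s₂, h₂⟩, rfl⟩
    refine (Set.finite_iUnion fun r => ?_).subset hsub
    by_contra hinf
    obtain ⟨_, n₁, ⟨s₁, h₁⟩, n₂, ⟨s₂, h₂⟩, -⟩ := (Set.not_finite.1 hinf).nonempty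
    by_cases hf₁ : {n | ∃ s, Pops R U p [X] r n s}.Finite
    · by_cases hf₂ : {n | ∃ s, Pops R U r γ q n s}.Finite
      · exact hinf (hf₁.image2 _ hf₂)
      · obtain ⟨a, k, hk, ha⟩ := ih r hf₂
        refine hcon ⟨n₁ + a, k, hk, fun i => ?_⟩
        obtain ⟨t, ht⟩ := ha i
        rw [add_assoc]
        exact ⟨_, (h₁.anti (Set.empty_subset _)).append ht⟩
    · obtain ⟨a, k, hk, ha⟩ := H p X r hf₁
      refine hcon ⟨a + n₂, k, hk, fun i => ?_⟩
      obtain ⟨t, ht⟩ := ha i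
      rw [add_right_comm]
      exact ⟨_, ht.append (h₂.anti (Set.empty_subset _))⟩

/-- Pumping: in a finite pushdown system, an infinite set of costs contains an infinite
arithmetic progression. -/
theorem pumps_of_infinite [Finite P] [Finite Γ]
    (hR : ∀ p X, {t : ℕ × P × List Γ | R p X t.1 t.2.1 t.2.2}.Finite) (γ : List Γ) (p q : P)
    (h : {n | ∃ s, Pops R U p γ q n s}.Infinite) : Pumps R p γ q := by
  induction hN : Uᶜ.ncard using Nat.strong_induction_on generalizing U p γ q with
  | _ N ih =>
    subst hN
    refine pumps_of_infinite_of_pumps_singleton (fun p X r hinf => ?_) γ p q h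
    by_contra hcon
    obtain ⟨n, s, hs⟩ := hinf.nonempty
    have hU : (p, X, r) ∉ U := by
      cases hs with
      | cons _ hU _ h₂ => cases h₂; exact hU
    have hlt : (insert (p, X, r) U)ᶜ.ncard < Uᶜ.ncard := by
      refine Set.ncard_lt_ncard ⟨Set.compl_subset_compl.2 (Set.subset_insert _ _), fun hle => ?_⟩
      exact hle hU (Set.mem_insert _ _)
    refine hinf (((hR p X).biUnion (t := fun t => (t.1 + ·) ''
      {n | ∃ s, Pops R (insert (p, X, r) U) t.2.1 t.2.2 r n s}) fun t ht => ?_).subset ?_)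
    · refine Set.Finite.image _ ?_
      by_contra hinf'
      obtain ⟨a, k, hk, ha⟩ := ih _ hlt _ _ _ hinf' rfl
      refine hcon ⟨t.1 + a, k, hk, fun i => ?_⟩
      obtain ⟨s, hs⟩ := ha i
      exact ⟨s + 0 + 1, by
        simpa [add_assoc] using Pops.cons ht (Set.notMem_empty _) hs (.nil r)⟩
    · rintro n ⟨s, hs⟩
      obtain ⟨c, p', γ, n', s', hc, hp, rfl⟩ := hs.pumps_or_exists_rule.resolve_left hcon
      exact Set.mem_biUnion (x := (c, p', γ)) hc ⟨n', ⟨s', hp⟩, rfl⟩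

end Pushdown

section CostedInput

variable {α J Q Γ : Type}

/-- `Path E j w n k` says that in the graph with edges `E`, labelled by letters and costs, the
word `w` labels a path of total cost `n` from `j` to `k`. -/
inductive Path (E : J → α → ℕ → J → Prop) : J → List α → ℕ → J → Prop
  | nil (j : J) : Path E j [] 0 j
  | cons {j j' k : J} {a : α} {w : List α} {c n : ℕ} (hE : E j a c j') (h : Path E j' w n k) :
      Path E j (a :: w) (c + n) k

theorem Path.append {E : J → α → ℕ → J → Prop} {j k l : J} {w w' : List α} {n n' : ℕ}
    (h : Path E j w n k) (h' : Path E k w' n' l) : Path E j (w ++ w') (n + n') l := by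
  induction h with
  | nil => simpa using h'
  | cons hE _ ih =>
    rw [add_assoc]
    exact .cons hE (ih h')

/-- The product of a PDA with a graph of costs. Once the state and vertex `t` are reached, the
stack may be emptied in the additional state `none`. -/
inductive PDA.Rule (M : PDA α Q Γ) (E : J → α → ℕ → J → Prop) (t : Q × J) :
    Option (Q × J) → Γ → ℕ → Option (Q × J) → List Γ → Prop
  | read {q p : Q} {j j' : J} {a : α} {c : ℕ} {X : Γ} {γ : List Γ}
      (h : (p, γ) ∈ M.trans q (some a) X) (hE : E j a c j') :
      Rule M E t (some (q, j)) X c (some (p, j')) γ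
  | eps {q p : Q} {j : J} {X : Γ} {γ : List Γ} (h : (p, γ) ∈ M.trans q none X) :
      Rule M E t (some (q, j)) X 0 (some (p, j)) γ
  | drain (X : Γ) : Rule M E t (some t) X 0 none []
  | drainNone (X : Γ) : Rule M E t none X 0 none []

variable {M : PDA α Q Γ} {E : J → α → ℕ → J → Prop} {t : Q × J}

theorem PDA.finite_setOf_rule [Finite α] [Finite J] (hE : ∀ j a c j', E j a c j' → c ≤ 1)
    (p : Option (Q × J)) (X : Γ) :
    {x : ℕ × Option (Q × J) × List Γ | M.Rule E t p X x.1 x.2.1 x.2.2}.Finite := by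
  have h₀ : ({(0, none, [])} : Set (ℕ × Option (Q × J) × List Γ)).Finite := Set.finite_singleton _
  rcases p with _ | ⟨q, j⟩
  · refine h₀.subset ?_
    rintro ⟨c, p', γ⟩ h
    cases h
    rfl
  · have hT : (⋃ o : Option α, (M.trans q o X : Set (Q × List Γ))).Finite :=
      Set.finite_iUnion fun o => (M.trans q o X).finite_toSet
    have h₁ := ((Set.finite_Iic 1).prod ((Set.finite_univ (α := J)).prod hT)).image
      (fun x : ℕ × J × Q × List Γ => (x.1, some (x.2.2.1, x.2.1), x.2.2.2))
    refine (h₀.union h₁).subset ?_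
    rintro ⟨c, p', γ⟩ h
    cases h with
    | @read _ p _ j' a _ _ _ h hE' =>
      exact .inr ⟨(c, j', p, γ), ⟨hE _ _ _ _ hE', trivial, Set.mem_iUnion.2 ⟨some a, h⟩⟩, rfl⟩
    | @eps _ p _ _ _ h =>
      exact .inr ⟨(0, j, p, γ), ⟨Set.mem_Iic.2 zero_le_one, trivial, Set.mem_iUnion.2 ⟨none, h⟩⟩, rfl⟩
    | drain => exact .inl rfl

theorem PDA.pops_drain (β : List Γ) : ∃ s, Pops (M.Rule E t) ∅ none β none 0 s := by
  induction β with
  | nil => exact ⟨0, .nil _⟩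
  | cons X β ih =>
    obtain ⟨s, hs⟩ := ih
    exact ⟨_, .cons (.drainNone X) (Set.notMem_empty _) (.nil _) hs⟩

theorem PDA.exists_pops_of_steps {c : Q × List α × List Γ} {β : List Γ}
    (h : Relation.ReflTransGen M.Step c (t.1, [], β)) {j : J} {n : ℕ}
    (hp : Path E j c.2.1 n t.2) :
    ∃ r : Bool, ∃ s, Pops (M.Rule E t) ∅ (some (c.1, j)) c.2.2 (if r then some t else none) n s := by
  induction h using Relation.ReflTransGen.head_induction_on generalizing j n with
  | refl =>
    cases hp
    cases β with
    | nil => exact ⟨true, 0, .nil _⟩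
    | cons X β =>
      obtain ⟨s, hs⟩ := M.pops_drain (E := E) (t := t) β
      exact ⟨false, _, .cons (.drain X) (Set.notMem_empty _) (.nil _) hs⟩
  | head hstep _ ih =>
    cases hstep with
    | read q p a w X γ β h =>
      cases hp with
      | cons hE hp =>
        obtain ⟨r, s, hs⟩ := ih hp
        obtain ⟨r', n₁, s₁, n₂, s₂, h₁, h₂, rfl⟩ := hs.exists_of_append
        rw [← add_assoc]
        exact ⟨r, _, .cons (.read h hE) (Set.notMem_empty _) h₁ h₂⟩
    | eps q p w X γ β h =>
      obtain ⟨r, s, hs⟩ := ih hp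
      obtain ⟨r', n₁, s₁, n₂, s₂, h₁, h₂, rfl⟩ := hs.exists_of_append
      refine ⟨r, s₁ + s₂ + 1, ?_⟩
      have := Pops.cons (.eps (j := j) h) (Set.notMem_empty _) h₁ h₂
      rwa [zero_add] at this

theorem PDA.pops_none {γ : List Γ} {r : Option (Q × J)} {n s : ℕ}
    (h : Pops (M.Rule E t) ∅ none γ r n s) : r = none ∧ n = 0 := by
  induction γ generalizing n s with
  | nil => cases h; exact ⟨rfl, rfl⟩
  | cons X γ ih =>
    cases h with
    | cons hR _ h₁ h₂ =>
      cases hR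
      cases h₁
      obtain ⟨rfl, rfl⟩ := ih h₂
      exact ⟨rfl, rfl⟩

/-- What a computation of the product system says about the PDA. -/
def PDA.Realizes (M : PDA α Q Γ) (E : J → α → ℕ → J → Prop) (t : Q × J) (p : Q) (j : J)
    (γ : List Γ) (n : ℕ) : Option (Q × J) → Prop
  | some (p', j') => ∃ w, Path E j w n j' ∧ ∀ w' δ,
      Relation.ReflTransGen M.Step (p, w ++ w', γ ++ δ) (p', w', δ)
  | none => ∃ w, Path E j w n t.2 ∧ ∀ δ, ∃ β,
      Relation.ReflTransGen M.Step (p, w, γ ++ δ) (t.1, [], β)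

theorem PDA.Realizes.trans {p p' : Q} {j j' : J} {γ γ' : List Γ} {n n' : ℕ}
    {r : Option (Q × J)} (h : M.Realizes E t p j γ n (some (p', j')))
    (h' : M.Realizes E t p' j' γ' n' r) : M.Realizes E t p j (γ ++ γ') (n + n') r := by
  obtain ⟨w, hw, hrun⟩ := h
  rcases r with _ | ⟨p'', j''⟩
  · obtain ⟨w', hw', hrun'⟩ := h'
    refine ⟨w ++ w', hw.append hw', fun δ => ?_⟩
    obtain ⟨β, hβ⟩ := hrun' δ
    refine ⟨β, ?_⟩
    rw [List.append_assoc]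
    exact (hrun w' (γ' ++ δ)).trans hβ
  · obtain ⟨w', hw', hrun'⟩ := h'
    refine ⟨w ++ w', hw.append hw', fun v δ => ?_⟩
    rw [List.append_assoc, List.append_assoc]
    exact (hrun (w' ++ v) (γ' ++ δ)).trans (hrun' v δ)

theorem PDA.Realizes.head {p p' : Q} {j j' : J} {X : Γ} {γ : List Γ} {c n : ℕ}
    {r : Option (Q × J)} (hR : M.Rule E t (some (p, j)) X c (some (p', j')) γ)
    (h : M.Realizes E t p' j' γ n r) : M.Realizes E t p j [X] (c + n) r := by
  cases hR with
  | @read _ _ _ _ a _ _ _ ht hE =>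
    rcases r with _ | ⟨p'', j''⟩
    · obtain ⟨w, hw, hrun⟩ := h
      refine ⟨a :: w, .cons hE hw, fun δ => ?_⟩
      obtain ⟨β, hβ⟩ := hrun δ
      exact ⟨β, .head (.read _ _ _ _ _ _ _ ht) hβ⟩
    · obtain ⟨w, hw, hrun⟩ := h
      exact ⟨a :: w, .cons hE hw, fun v δ => .head (.read _ _ _ _ _ _ _ ht) (hrun v δ)⟩
  | eps ht =>
    rw [zero_add]
    rcases r with _ | ⟨p'', j''⟩
    · obtain ⟨w, hw, hrun⟩ := h
      refine ⟨w, hw, fun δ => ?_⟩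
      obtain ⟨β, hβ⟩ := hrun δ
      exact ⟨β, .head (.eps _ _ _ _ _ _ ht) hβ⟩
    · obtain ⟨w, hw, hrun⟩ := h
      exact ⟨w, hw, fun v δ => .head (.eps _ _ _ _ _ _ ht) (hrun v δ)⟩

theorem PDA.realizes_of_pops {x r : Option (Q × J)} {γ : List Γ} {n s : ℕ}
    (h : Pops (M.Rule E t) ∅ x γ r n s) {p : Q} {j : J} (hx : x = some (p, j)) :
    M.Realizes E t p j γ n r := by
  induction h generalizing p j with
  | nil =>
    subst hx
    exact ⟨[], .nil j, fun _ _ => .refl⟩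
  | @cons _ p' x' r X γ β c n₁ n₂ s₁ s₂ hR _ h₁ h₂ ih₁ ih₂ =>
    subst hx
    have key : M.Realizes E t p j [X] (c + n₁) x' := by
      rcases p' with _ | ⟨p', j'⟩
      · cases hR
        obtain ⟨rfl, rfl⟩ := pops_none h₁
        exact ⟨[], .nil _, fun δ => ⟨_, .refl⟩⟩
      · exact .head hR (ih₁ rfl)
    rcases x' with _ | ⟨p', j'⟩
    · obtain ⟨rfl, rfl⟩ := pops_none h₂
      obtain ⟨w, hw, hrun⟩ := key
      exact ⟨w, hw, fun δ => hrun (β ++ δ)⟩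
    · exact key.trans (ih₂ rfl)

/-- Pumping for push-down automata. -/
theorem PDA.exists_progression [Finite α] [Finite J] [Finite Q] [Finite Γ]
    (hE : ∀ j a c j', E j a c j' → c ≤ 1) (j₀ j₁ : J)
    (h : ∀ n, ∃ w q, Path E j₀ w n j₁ ∧ M.AcceptsIn w q) :
    ∃ q a k, 0 < k ∧ ∀ i, ∃ w, Path E j₀ w (a + i * k) j₁ ∧ M.AcceptsIn w q := by
  have hcover : (Set.univ : Set ℕ) ⊆ ⋃ q : Q, ⋃ r : Bool, {n | q ∈ M.accept ∧
      ∃ s, Pops (M.Rule E (q, j₁)) ∅ (some (M.start, j₀)) [M.startSymbol]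
        (if r then some (q, j₁) else none) n s} := by
    intro n _
    obtain ⟨w, q, hw, hq, β, hβ⟩ := h n
    obtain ⟨r, s, hs⟩ := exists_pops_of_steps (t := (q, j₁)) hβ hw
    exact Set.mem_iUnion.2 ⟨q, Set.mem_iUnion.2 ⟨r, hq, s, hs⟩⟩
  have hinf := Set.infinite_univ.mono hcover
  have : ∃ q : Q, ∃ r : Bool, {n | q ∈ M.accept ∧
      ∃ s, Pops (M.Rule E (q, j₁)) ∅ (some (M.start, j₀)) [M.startSymbol]
        (if r then some (q, j₁) else none) n s}.Infinite := by
    by_contra! hcon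
    exact hinf (Set.finite_iUnion fun q => Set.finite_iUnion fun r => hcon q r)
  obtain ⟨q, r, hqr⟩ := this
  obtain ⟨-, hq, -⟩ := hqr.nonempty
  obtain ⟨a, k, hk, ha⟩ := pumps_of_infinite (M.finite_setOf_rule hE) _ _ _
    (hqr.mono fun n hn => hn.2)
  refine ⟨q, a, k, hk, fun i => ?_⟩
  obtain ⟨s, hs⟩ := ha i
  have hreal := realizes_of_pops hs rfl
  cases r
  · obtain ⟨w, hw, hrun⟩ := hreal
    obtain ⟨β, hβ⟩ := hrun []
    exact ⟨w, hw, hq, β, by simpa using hβ⟩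
  · obtain ⟨w, hw, hrun⟩ := hreal
    exact ⟨w, hw, hq, [], by simpa using hrun [] []⟩

end CostedInput

section Significand

variable {d n m : ℕ} {r : ℝ}

/-- `2 * d` times the lower end of the interval rounded to the significand `m`. -/
def lowerEnd (d n m : ℕ) : ℕ := if m = d ^ (n - 1) then 2 * d * m - 1 else 2 * d * m - d

/-- `2 * d` times the upper end of the interval rounded to the significand `m`. -/
def upperEnd (d m : ℕ) : ℕ := 2 * d * m + d

theorem cast_lowerEnd (hd : 2 ≤ d) (hm : 1 ≤ m) :
    (lowerEnd d n m : ℝ) = 2 * d * m - if m = d ^ (n - 1) then 1 else (d : ℝ) := by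
  have h : d ≤ 2 * d * m := by nlinarith
  unfold lowerEnd
  split_ifs
  · push_cast [Nat.cast_sub (show 1 ≤ 2 * d * m by omega)]
    ring
  · push_cast [Nat.cast_sub h]
    ring

theorem isBestSignificand_iff (hd : 2 ≤ d) : IsBestSignificand d n r m ↔
    d ^ (n - 1) ≤ m ∧ m < d ^ n ∧ ∃ q : ℤ, lowerEnd d n m * (d : ℝ) ^ q ≤ 2 * d * r ∧
      2 * d * r ≤ upperEnd d m * (d : ℝ) ^ q := by
  have hd0 : (0 : ℝ) < d := by exact_mod_cast (by omega : 0 < d)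
  have hd2 : (2 : ℝ) ≤ d := by exact_mod_cast hd
  unfold IsBestSignificand
  refine and_congr_right fun h₁ => and_congr_right fun h₂ => exists_congr fun q => ?_
  have hm : 1 ≤ m := (Nat.one_le_pow _ _ (by omega)).trans h₁
  have hq : (0 : ℝ) < (d : ℝ) ^ q := zpow_pos hd0 q
  rw [cast_lowerEnd hd hm, upperEnd]
  push_cast
  constructor
  · rintro ⟨ε, rfl, hε, hε'⟩
    rw [abs_le] at hε
    rw [← mul_assoc]
    refine ⟨mul_le_mul_of_nonneg_right ?_ hq.le, mul_le_mul_of_nonneg_right ?_ hq.le⟩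
    · split_ifs with h
      · have h1 := mul_le_mul_of_nonneg_left (hε' h) (show (0 : ℝ) ≤ 2 * d by positivity)
        rw [mul_neg, mul_one_div_cancel (by positivity)] at h1
        linarith
      · nlinarith
    · nlinarith
  · rintro ⟨hl, hu⟩
    have hr : r = (m + (r / (d : ℝ) ^ q - m)) * (d : ℝ) ^ q := by field_simp; ring
    set ε := r / (d : ℝ) ^ q - m
    rw [hr, ← mul_assoc] at hl hu
    have hl := le_of_mul_le_mul_right hl hq
    have hu := le_of_mul_le_mul_right hu hq
    have hu' : ε ≤ 1 / 2 := by
      by_contra! h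
      nlinarith
    refine ⟨ε, hr, abs_le.2 ⟨?_, hu'⟩, fun h => ?_⟩
    · split_ifs at hl
      · by_contra! h
        nlinarith
      · by_contra! h
        nlinarith
    · rw [if_pos h] at hl
      rw [neg_le_iff_add_nonneg, ← mul_nonneg_iff_of_pos_left (show (0 : ℝ) < 2 * d by positivity),
        mul_add, mul_one_div_cancel (by positivity)]
      linarith

theorem exists_isBestSignificand (hd : 2 ≤ d) (hn : 1 ≤ n) (hr : 0 < r) :
    ∃ m, IsBestSignificand d n r m := by
  have hd1 : (1 : ℝ) < d := by exact_mod_cast (by omega : 1 < d)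
  have hd0 : (0 : ℝ) < d := by linarith
  obtain ⟨q', hq'⟩ := exists_mem_Ico_zpow hr hd1
  obtain ⟨q, rfl⟩ : ∃ q : ℤ, q' = (n - 1 : ℕ) + q := ⟨q' - (n - 1 : ℕ), by ring⟩
  have hq : (0 : ℝ) < (d : ℝ) ^ q := zpow_pos hd0 q
  obtain ⟨k, rfl⟩ : ∃ k, n = k + 1 := ⟨n - 1, by omega⟩
  simp only [Nat.add_sub_cancel, Set.mem_Ico] at hq'
  rw [show ((k : ℤ) + q + 1) = ((k + 1 : ℕ) : ℤ) + q by push_cast; ring,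
    zpow_add₀ hd0.ne', zpow_add₀ hd0.ne', zpow_natCast, zpow_natCast] at hq'
  obtain ⟨y, rfl⟩ : ∃ y, r = y * (d : ℝ) ^ q := ⟨r / (d : ℝ) ^ q, by field_simp⟩
  have hy₁ : (d : ℝ) ^ k ≤ y := le_of_mul_le_mul_right hq'.1 hq
  have hy₂ : y < (d : ℝ) ^ (k + 1) := lt_of_mul_lt_mul_right hq'.2 hq.le
  have hy0 : 0 ≤ y + 1 / 2 := by have := pow_pos hd0 k; linarith
  have hf₁ := Nat.floor_le hy0
  have hf₂ := Nat.lt_floor_add_one (y + 1 / 2)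
  set m := ⌊y + 1 / 2⌋₊ with hm
  have hmk : d ^ k ≤ m := Nat.le_floor (by push_cast; linarith)
  rcases lt_or_ge m (d ^ (k + 1)) with h | h
  · refine ⟨m, by simpa using hmk, h, q, y - m, by ring, abs_le.2 ⟨by linarith, by linarith⟩, ?_⟩
    intro he
    have : (0 : ℝ) ≤ 1 / (2 * d) := by positivity
    have hmd : (m : ℝ) = (d : ℝ) ^ k := by rw [he]; simp
    linarith
  · have h' : (d : ℝ) ^ (k + 1) ≤ m := by exact_mod_cast h
    have hmul : (d : ℝ) * (y / d - (d : ℝ) ^ k) = y - (d : ℝ) ^ (k + 1) := by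
      field_simp
      ring
    refine ⟨d ^ k, by simp, Nat.pow_lt_pow_right (by omega) (by omega), q + 1,
      y / d - (d : ℝ) ^ k, ?_, ?_, fun _ => ?_⟩
    · rw [zpow_add_one₀ hd0.ne']
      push_cast
      field_simp
      ring
    · rw [abs_le]
      constructor <;> by_contra! hc <;> nlinarith
    · by_contra! hc
      have := mul_lt_mul_of_pos_left hc hd0
      rw [hmul, mul_neg, mul_one_div, div_mul_cancel_right₀ hd0.ne'] at this
      linarith

theorem exists_isSignificand (tie : TieRule) (hd : 2 ≤ d) (hn : 1 ≤ n) (hr : 0 < r) :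
    ∃ m, IsSignificand tie d n r m := by
  obtain ⟨m, hm⟩ := exists_isBestSignificand hd hn hr
  cases tie with
  | either => exact ⟨m, hm⟩
  | toEven =>
    by_cases h : ∃ m', IsBestSignificand d n r m' ∧ Even m'
    · obtain ⟨m', h₁, h₂⟩ := h
      exact ⟨m', h₁, .inl h₂⟩
    · push Not at h
      exact ⟨m, hm, .inr h⟩

theorem IsSignificand.isBestSignificand {tie : TieRule} (h : IsSignificand tie d n r m) :
    IsBestSignificand d n r m := by
  cases tie with
  | either => exact h
  | toEven => exact h.1

theorem setOf_isSignificand_congr {r' : ℝ} (tie : TieRule)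
    (h : ∀ m, IsBestSignificand d n r m ↔ IsBestSignificand d n r' m) :
    {m | IsSignificand tie d n r m} = {m | IsSignificand tie d n r' m} := by
  ext m
  cases tie <;> simp [IsSignificand, h]

theorem isBestSignificand_mul_zpow (hd : 2 ≤ d) (j : ℤ) :
    IsBestSignificand d n (r * (d : ℝ) ^ j) m ↔ IsBestSignificand d n r m := by
  have hd0 : (0 : ℝ) < d := by exact_mod_cast (by omega : 0 < d)
  have hj : (0 : ℝ) < (d : ℝ) ^ j := zpow_pos hd0 j
  unfold IsBestSignificand
  refine and_congr_right fun _ => and_congr_right fun _ => ?_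
  rw [← (Equiv.addRight j).exists_congr_right]
  refine exists_congr fun q => exists_congr fun ε => and_congr_left fun _ => ?_
  rw [Equiv.coe_addRight, zpow_add₀ hd0.ne', ← mul_assoc]
  exact mul_left_inj' hj.ne'

/-- The multiples of an irrational number, shifted, do not all stay in an interval of length less
than one modulo the integers. -/
theorem not_forall_mem_Icc_add_intCast {θ x A B : ℝ} (hθ : Irrational θ) (hAB : B < A + 1) :
    ¬ ∀ i : ℕ, ∃ q : ℤ, x + i * θ - q ∈ Set.Icc A B := by
  intro h
  have hdense : DenseRange ((· • (θ : AddCircle (1 : ℝ))) : ℕ → AddCircle (1 : ℝ)) :=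
    denseRange_zsmul_iff_nsmul.1 (AddCircle.denseRange_zsmul_coe_iff.2 (by simpa using hθ))
  have hopen : IsOpen (((↑) : ℝ → AddCircle (1 : ℝ)) '' Set.Ioo (B - x) (A + 1 - x)) :=
    QuotientAddGroup.isOpenMap_coe _ isOpen_Ioo
  obtain ⟨i, hi⟩ := hdense.exists_mem_open hopen
    ((Set.nonempty_Ioo.2 (by linarith)).image _)
  obtain ⟨y, hy, hyi⟩ := hi
  obtain ⟨q, hq⟩ := h i
  have : ((y - i • θ : ℝ) : AddCircle (1 : ℝ)) = 0 := by
    rw [AddCircle.coe_sub, AddCircle.coe_nsmul, hyi, sub_self]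
  obtain ⟨z, hz⟩ := (AddCircle.coe_eq_zero_iff 1).1 this
  simp only [zsmul_eq_mul, mul_one, nsmul_eq_mul] at hz
  obtain ⟨h₁, h₂⟩ := hq
  obtain ⟨h₃, h₄⟩ := hy
  have e₁ : (-1 : ℝ) < -z - q := by linarith
  have e₂ : (-z - q : ℝ) < 0 := by linarith
  have e₁' : (-1 : ℤ) < -z - q := by exact_mod_cast e₁
  have e₂' : (-z - q : ℤ) < 0 := by exact_mod_cast e₂
  omega

theorem not_forall_isBestSignificand_pow {D : ℕ} (hd : 2 ≤ d) (hD : 2 ≤ D)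
    (hdn : 2 < d ∨ 1 < n) (hirr : Irrational (Real.logb d D)) (a k : ℕ) (hk : 0 < k) :
    ¬ ∀ i : ℕ, IsBestSignificand d n ((D : ℝ) ^ (a + i * k)) m := by
  intro h
  have hd1 : (1 : ℝ) < d := by exact_mod_cast (by omega : 1 < d)
  have hd0 : (0 : ℝ) < d := by linarith
  have hD0 : (0 : ℝ) < D := by exact_mod_cast (by omega : 0 < D)
  have hm₁ : d ^ (n - 1) ≤ m := (h 0).1
  have hm : 1 ≤ m := (Nat.one_le_pow _ _ (by omega)).trans hm₁
  have hlow0 : 0 < lowerEnd d n m := by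
    unfold lowerEnd
    have : d * 1 ≤ d * m := Nat.mul_le_mul_left d hm
    split_ifs <;> rw [mul_assoc] <;> omega
  have hup0 : 0 < upperEnd d m := by unfold upperEnd; omega
  have hlt : upperEnd d m < d * lowerEnd d n m := by
    unfold upperEnd lowerEnd
    split_ifs with he
    · have h2 : d = 2 → 2 ≤ m := by
        intro h2
        rw [he]
        calc 2 ≤ d := hd
          _ = d ^ 1 := (pow_one d).symm
          _ ≤ d ^ (n - 1) := Nat.pow_le_pow_right (by omega) (by omega)
      zify [show 1 ≤ 2 * d * m by nlinarith]
      rcases hd.eq_or_lt with rfl | hd3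
      · have := h2 rfl
        push_cast
        nlinarith
      · have hd3' : (3 : ℤ) ≤ d := by exact_mod_cast hd3
        have hm' : (1 : ℤ) ≤ m := by exact_mod_cast hm
        nlinarith [mul_le_mul hm' (mul_le_mul hd3' hd3' (by norm_num) (by linarith))
          (by norm_num) (by linarith), mul_le_mul hd3' hm' (by norm_num) (by linarith)]
    · have hm2 : 2 ≤ m := by
        have := Nat.one_le_pow (n - 1) d (by omega)
        omega
      zify [show d ≤ 2 * d * m by nlinarith]
      have hd2' : (2 : ℤ) ≤ d := by exact_mod_cast hd
      have hm2' : (2 : ℤ) ≤ m := by exact_mod_cast hm2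
      have e : (d : ℤ) * (2 * d * m - d) - (2 * d * m + d) = d * ((d - 1) * (2 * m - 1) - 2) := by
        ring
      have : (0 : ℤ) < d * ((d - 1) * (2 * m - 1) - 2) :=
        mul_pos (by linarith) (by nlinarith)
      linarith
  have hlow0' : (0 : ℝ) < lowerEnd d n m := by exact_mod_cast hlow0
  have hup0' : (0 : ℝ) < upperEnd d m := by exact_mod_cast hup0
  refine not_forall_mem_Icc_add_intCast (hirr.mul_natCast hk.ne') (x := a * Real.logb d D)
    (A := Real.logb d (lowerEnd d n m) - Real.logb d (2 * d))
    (B := Real.logb d (upperEnd d m) - Real.logb d (2 * d)) ?_ fun i => ?_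
  · have : Real.logb d (upperEnd d m) < Real.logb d (d * lowerEnd d n m) :=
      Real.logb_lt_logb hd1 hup0' (by exact_mod_cast hlt)
    rw [Real.logb_mul hd0.ne' hlow0'.ne', Real.logb_self_eq_one hd1] at this
    linarith
  · obtain ⟨-, -, q, hl, hu⟩ := (isBestSignificand_iff hd).1 (h i)
    have hq : (0 : ℝ) < (d : ℝ) ^ q := zpow_pos hd0 q
    have hp : (0 : ℝ) < (D : ℝ) ^ (a + i * k) := pow_pos hD0 _
    have e : Real.logb d (2 * d * (D : ℝ) ^ (a + i * k)) =
        Real.logb d (2 * d) + (a * Real.logb d D + i * (Real.logb d D * k)) := by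
      rw [Real.logb_mul (by positivity) hp.ne', Real.logb_pow]
      push_cast
      ring
    have ez : ∀ x : ℝ, 0 < x → Real.logb d (x * (d : ℝ) ^ q) = Real.logb d x + q := by
      intro x hx
      rw [Real.logb_mul hx.ne' hq.ne', ← Real.rpow_intCast, Real.logb_rpow hd0 hd1.ne']
    have hl' := Real.logb_le_logb_of_le hd1 (by positivity) hl
    have hu' := Real.logb_le_logb_of_le hd1 (by positivity) hu
    rw [e, ez _ hlow0'] at hl'
    rw [e, ez _ hup0'] at hu'
    exact ⟨q, by linarith, by linarith⟩

end Significand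

section PushdownSolvable

theorem SolvableByDFA.solvableByPDA {α : Type} {P : Problem α} (h : SolvableByDFA P) :
    SolvableByPDA P := by
  obtain ⟨Q, hQ, M, out, hM⟩ := h
  let N : PDA α Q Unit :=
    { trans := fun q o _ => o.elim ∅ fun a => {(M.step q a, [()])}
      start := M.start
      startSymbol := ()
      accept := M.accept }
  have hstep : ∀ (w : List α) (q : Q),
      Relation.ReflTransGen N.Step (q, w, [()]) (M.evalFrom q w, [], [()]) := by
    intro w
    induction w with
    | nil => exact fun q => .refl
    | cons a w ih =>
      intro q
      exact .head (.read q (M.step q a) a w () [()] [] (by simp [N])) (ih (M.step q a))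
  have hinv : ∀ x y, N.Step x y → M.evalFrom x.1 x.2.1 = M.evalFrom y.1 y.2.1 := by
    rintro _ _ (⟨q, p, a, w, X, γ, β, h⟩ | ⟨q, p, w, X, γ, β, h⟩)
    · simp only [N, Option.elim_some, Finset.mem_singleton, Prod.mk.injEq] at h
      rw [h.1]
      rfl
    · simp [N] at h
  have hruns : ∀ x y, Relation.ReflTransGen N.Step x y →
      M.evalFrom x.1 x.2.1 = M.evalFrom y.1 y.2.1 := by
    intro x y hxy
    induction hxy with
    | refl => rfl
    | tail _ hs ih => exact ih.trans (hinv _ _ hs)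
  refine ⟨Q, Unit, hQ, inferInstance, N, out, fun w S hw => ?_⟩
  obtain ⟨hacc, hout⟩ := hM w S hw
  refine ⟨⟨M.eval w, hacc, [()], hstep w _⟩, ?_⟩
  rintro q ⟨-, β, hβ⟩
  have : M.eval w = q := hruns _ _ hβ
  rwa [← this]

instance finite_letter (D b : ℕ) : Finite (Letter D b) :=
  Finite.of_injective (β := (Fin D ⊕ Fin b) ⊕ Fin 3)
    (fun l => match l with
      | .sig x => .inl (.inl x)
      | .exp x => .inl (.inr x)
      | .plus => .inr 0
      | .minus => .inr 1
      | .endMark => .inr 2)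
    (by rintro (_ | _ | _ | _ | _) (_ | _ | _ | _ | _) h <;> simp_all)

/-- The cost of a zero read before (`false`) or after (`true`) the only nonzero digit: it is `1`
if the zero contributes to the value and `0` if it is a leading zero. -/
def zeroCost : DigitOrder → Bool → ℕ
  | .leastFirst, side => if side then 0 else 1
  | .mostFirst, side => if side then 1 else 0

/-- A graph accepting the inputs for `f = D ^ n`, `e = 0`, at cost `n`. -/
inductive PowerEdge (D b : ℕ) (ord : DigitOrder) : Fin 4 → Letter (D + 2) b → ℕ → Fin 4 → Prop
  | before : PowerEdge D b ord 0 (.sig 0) (zeroCost ord false) 0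
  | one : PowerEdge D b ord 0 (.sig 1) 0 1
  | after : PowerEdge D b ord 1 (.sig 0) (zeroCost ord true) 1
  | plus : PowerEdge D b ord 1 .plus 0 2
  | finish : PowerEdge D b ord 2 .endMark 0 3

variable {D b : ℕ} {ord : DigitOrder}

theorem PowerEdge.cost_le {j j' : Fin 4} {a : Letter (D + 2) b} {c : ℕ}
    (h : PowerEdge D b ord j a c j') : c ≤ 1 := by
  cases h <;> cases ord <;> simp [zeroCost]

theorem path_power_one {w : List (Letter (D + 2) b)} {n : ℕ} {j k : Fin 4}
    (h : Path (PowerEdge D b ord) j w n k) (hj : j = 1) (hk : k = 3) :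
    ∃ i, n = i * zeroCost ord true ∧
      w = (List.replicate i (0 : Fin (D + 2))).map .sig ++ [.plus, .endMark] := by
  induction h with
  | nil => omega
  | cons hE h ih =>
    cases hE with
    | after =>
      obtain ⟨i, rfl, rfl⟩ := ih rfl hk
      exact ⟨i + 1, by ring, by simp [List.replicate_succ]⟩
    | plus =>
      subst hk
      rcases h with _ | ⟨_ | _, h⟩
      rcases h with _ | ⟨_ | _, h⟩
      exact ⟨0, by simp, by simp⟩
    | before => simp at hj
    | one => simp at hj
    | finish => simp at hj

theorem path_power_zero {w : List (Letter (D + 2) b)} {n : ℕ} {j k : Fin 4}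
    (h : Path (PowerEdge D b ord) j w n k) (hj : j = 0) (hk : k = 3) :
    ∃ i i', n = i * zeroCost ord false + i' * zeroCost ord true ∧
      w = (List.replicate i (0 : Fin (D + 2)) ++ 1 :: List.replicate i' 0).map .sig ++
        [.plus, .endMark] := by
  induction h with
  | nil => omega
  | cons hE h ih =>
    cases hE with
    | before =>
      obtain ⟨i, i', rfl, rfl⟩ := ih rfl hk
      exact ⟨i + 1, i', by ring, by simp [List.replicate_succ]⟩
    | one =>
      obtain ⟨i', rfl, rfl⟩ := path_power_one h rfl hk
      exact ⟨0, i', by simp, by simp⟩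
    | after => simp at hj
    | plus => simp at hj
    | finish => simp at hj

theorem value_power (i i' : ℕ) :
    value ord (List.replicate i (0 : Fin (D + 2)) ++ 1 :: List.replicate i' 0) =
      (D + 2) ^ (i * zeroCost ord false + i' * zeroCost ord true) := by
  have h (i i' : ℕ) : Nat.ofDigits (D + 2)
      ((List.replicate i (0 : Fin (D + 2)) ++ 1 :: List.replicate i' 0).map Fin.val) =
        (D + 2) ^ i := by
    simp [Nat.ofDigits_append, Nat.ofDigits_replicate_zero, Nat.ofDigits_cons]
  cases ord with
  | leastFirst => simpa [value, zeroCost] using h i i'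
  | mostFirst => simpa [value, zeroCost] using h i' i

theorem exists_path_power (D b : ℕ) (ord : DigitOrder) (n : ℕ) :
    ∃ w, Path (PowerEdge D b ord) 0 w n 3 := by
  have tail : Path (PowerEdge D b ord) 1 [.plus, .endMark] 0 3 :=
    .cons PowerEdge.plus (.cons PowerEdge.finish (.nil 3))
  cases ord with
  | leastFirst =>
    induction n with
    | zero => exact ⟨_, .cons PowerEdge.one tail⟩
    | succ n ih =>
      obtain ⟨w, hw⟩ := ih
      rw [add_comm n]
      exact ⟨_, .cons PowerEdge.before hw⟩
  | mostFirst =>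
    have : ∃ w, Path (PowerEdge D b .mostFirst) 1 w n 3 := by
      induction n with
      | zero => exact ⟨_, tail⟩
      | succ n ih =>
        obtain ⟨w, hw⟩ := ih
        rw [add_comm n]
        exact ⟨_, .cons PowerEdge.after hw⟩
    obtain ⟨w, hw⟩ := this
    rw [← zero_add n]
    exact ⟨_, .cons PowerEdge.one hw⟩

theorem mem_clingerProblem_of_path {d n : ℕ} {ordE : DigitOrder} {tie : TieRule}
    {w : List (Letter (D + 2) b)} {N : ℕ} (h : Path (PowerEdge D b ord) 0 w N 3) :
    (w, {m | IsSignificand tie d n (((D + 2 : ℕ) : ℝ) ^ N) m}) ∈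
      clingerProblem d (D + 2) b n ord ordE tie := by
  obtain ⟨i, i', rfl, rfl⟩ := path_power_zero h rfl rfl
  refine ⟨List.replicate i 0 ++ 1 :: List.replicate i' 0, false, [], ?_, ?_⟩
  · rw [value_power]
    positivity
  · have h0 : value ordE ([] : List (Fin b)) = 0 := by cases ordE <;> rfl
    rw [value_power, h0]
    simp [encode, signed]

theorem commensurable_of_solvableByPDA {d D b n : ℕ} (hd : 2 ≤ d) (hD : 2 ≤ D)
    (hdn : 2 < d ∨ 1 < n) {ordF ordE : DigitOrder} {tie : TieRule}
    (h : SolvableByPDA (clingerProblem d D b n ordF ordE tie)) : Commensurable d D := by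
  intro hirr
  obtain ⟨D, rfl⟩ : ∃ D', D = D' + 2 := ⟨D - 2, by omega⟩
  obtain ⟨Q, Γ, _, _, M, out, hM⟩ := h
  obtain ⟨q, a, k, hk, hq⟩ := PDA.exists_progression (M := M) (E := PowerEdge D b ordF)
    (fun _ _ _ _ h => h.cost_le) 0 3 fun N => by
      obtain ⟨w, hw⟩ := exists_path_power D b ordF N
      obtain ⟨q, hq⟩ := (hM w _ (mem_clingerProblem_of_path hw)).1
      exact ⟨w, q, hw, hq⟩
  refine not_forall_isBestSignificand_pow (m := out q) hd hD hdn hirr a k hk fun i => ?_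
  obtain ⟨w, hw, hacc⟩ := hq i
  exact IsSignificand.isBestSignificand ((hM w _ (mem_clingerProblem_of_path hw)).2 q hacc)

end PushdownSolvable

section Automatic

variable {A X : Type}

/-- `φ` depends only on the state that some finite automaton reaches. -/
def Automatic (φ : List A → X) : Prop :=
  ∃ (Q : Type) (_ : Finite Q) (step : Q → A → Q) (q₀ : Q),
    ∀ u u', u.foldl step q₀ = u'.foldl step q₀ → φ u = φ u'

theorem automatic_of_congruence {φ : List A → X} (hfin : (Set.range φ).Finite)
    (h : ∀ u u' x, φ u = φ u' → φ (u ++ [x]) = φ (u' ++ [x])) : Automatic φ := by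
  let step : Set.range φ → A → Set.range φ := fun q x => ⟨φ (q.2.choose ++ [x]), _, rfl⟩
  have key : ∀ u : List A, u.foldl step ⟨φ [], [], rfl⟩ = ⟨φ u, u, rfl⟩ := by
    intro u
    induction u using List.reverseRecOn with
    | nil => rfl
    | append_singleton u x ih =>
      rw [List.foldl_append, ih]
      exact Subtype.ext (h _ _ x (show φ u ∈ Set.range φ from ⟨u, rfl⟩).choose_spec)
  refine ⟨Set.range φ, hfin, step, ⟨φ [], [], rfl⟩, fun u u' he => ?_⟩
  rw [key, key] at he
  exact congrArg Subtype.val he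

theorem Automatic.comp_reverse {φ : List A → X} (h : Automatic φ) :
    Automatic fun u => φ u.reverse := by
  obtain ⟨Q, hQ, step, q₀, hφ⟩ := h
  have key : ∀ (u : List A) (F : Q → Q),
      u.foldl (fun F a q => F (step q a)) F q₀ = F (u.reverse.foldl step q₀) := by
    intro u
    induction u with
    | nil => exact fun F => rfl
    | cons a u ih =>
      intro F
      rw [List.foldl_cons, ih]
      simp
  refine ⟨Q → Q, inferInstance, fun F a q => F (step q a), id, fun u u' he => hφ _ _ ?_⟩
  have := congrFun he q₀
  rwa [key, key] at this

/-- The digits in the order of increasing significance. -/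
def leastFirstDigits {b : ℕ} : DigitOrder → List (Fin b) → List (Fin b)
  | .leastFirst, u => u
  | .mostFirst, u => u.reverse

theorem value_eq_value_leastFirst {b : ℕ} (ord : DigitOrder) (u : List (Fin b)) :
    value ord u = value .leastFirst (leastFirstDigits ord u) := by
  cases ord <;> rfl

theorem Automatic.comp_leastFirstDigits {b : ℕ} {φ : List (Fin b) → X} (h : Automatic φ)
    (ord : DigitOrder) : Automatic fun u => φ (leastFirstDigits ord u) := by
  cases ord with
  | leastFirst => exact h
  | mostFirst => exact h.comp_reverse

theorem value_concat {b : ℕ} (u : List (Fin b)) (x : Fin b) :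
    value .leastFirst (u ++ [x]) = value .leastFirst u + b ^ u.length * x := by
  simp [value, Nat.ofDigits_append]

theorem value_lt {b : ℕ} (u : List (Fin b)) : value .leastFirst u < b ^ u.length := by
  induction u using List.reverseRecOn with
  | nil => simp [value]
  | append_singleton u x ih =>
    rw [value_concat, List.length_append, List.length_singleton, pow_succ]
    have := Nat.mul_le_mul_left (b ^ u.length) x.2
    rw [Nat.mul_succ] at this
    omega

theorem automatic_value_mod (b : ℕ) {t : ℕ} (ht : 0 < t) :
    Automatic fun u : List (Fin b) => (value .leastFirst u % t, b ^ u.length % t) := by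
  refine automatic_of_congruence (((Set.finite_Iio t).prod (Set.finite_Iio t)).subset ?_) ?_
  · rintro _ ⟨u, rfl⟩
    exact ⟨Nat.mod_lt _ ht, Nat.mod_lt _ ht⟩
  · intro u u' x h
    simp only [Prod.mk.injEq] at h ⊢
    obtain ⟨h₁ : _ ≡ _ [MOD t], h₂ : _ ≡ _ [MOD t]⟩ := h
    rw [value_concat, value_concat, List.length_append, List.length_append, pow_add, pow_add]
    exact ⟨h₁.add (h₂.mul_right _), h₂.mul_right _⟩

/-- The position of `f / D ^ k` relative to the multiples of `1 / M`, and `k` modulo `t`, where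
`k` is the number of digits of `f`. -/
def cell {D : ℕ} (M t : ℕ) (u : List (Fin D)) : ℕ × Set ℕ × Set ℕ :=
  (u.length % t, {i | i * D ^ u.length ≤ value .leastFirst u * M},
    {i | value .leastFirst u * M ≤ i * D ^ u.length})

theorem finite_range_cell (D M : ℕ) {t : ℕ} (ht : 0 < t) :
    (Set.range (cell (D := D) M t)).Finite := by
  have hS : (𝒫 (Set.Iic M) : Set (Set ℕ)).Finite := (Set.finite_Iic M).finite_subsets
  have hT : {s : Set ℕ | sᶜ ∈ 𝒫 (Set.Iic M)}.Finite :=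
    Set.Finite.preimage (compl_injective.injOn) hS
  refine ((Set.finite_Iio t).prod (hS.prod hT)).subset ?_
  rintro _ ⟨u, rfl⟩
  have hlt := value_lt u
  have h0 : 0 < D ^ u.length := by omega
  refine ⟨Nat.mod_lt _ ht, fun i hi => ?_, fun i hi => ?_⟩
  · have hi : i * D ^ u.length ≤ value .leastFirst u * M := hi
    refine Nat.le_of_mul_le_mul_right (hi.trans ?_) h0
    rw [mul_comm M]
    exact Nat.mul_le_mul_right M hlt.le
  · have hi : ¬ value .leastFirst u * M ≤ i * D ^ u.length := hi
    by_contra hM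
    have hM : M < i := not_le.1 hM
    refine hi ?_
    rw [mul_comm i]
    exact Nat.mul_le_mul hlt.le hM.le

theorem cell_concat {D M t : ℕ} {u u' : List (Fin D)} (x : Fin D)
    (h : cell M t u = cell M t u') : cell M t (u ++ [x]) = cell M t (u' ++ [x]) := by
  have hD : 0 < D := x.pos
  simp only [cell, Prod.mk.injEq] at h ⊢
  obtain ⟨h₁, h₂, h₃⟩ := h
  have lower (u : List (Fin D)) (i : ℕ) :
      i * D ^ (u ++ [x]).length ≤ value .leastFirst (u ++ [x]) * M ↔
        (i * D - x * M) * D ^ u.length ≤ value .leastFirst u * M := by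
    rw [value_concat, List.length_append, List.length_singleton, pow_succ, Nat.sub_mul,
      tsub_le_iff_right]
    ring_nf
  have upper (u : List (Fin D)) (i : ℕ) :
      value .leastFirst (u ++ [x]) * M ≤ i * D ^ (u ++ [x]).length ↔
        x * M ≤ i * D ∧ value .leastFirst u * M ≤ (i * D - x * M) * D ^ u.length := by
    have h0 : 0 < D ^ u.length := pow_pos hD _
    rw [value_concat, List.length_append, List.length_singleton, pow_succ]
    constructor
    · intro h
      have hle : x * M ≤ i * D := by
        refine Nat.le_of_mul_le_mul_right ?_ h0
        calc x * M * D ^ u.length ≤ (value .leastFirst u + D ^ u.length * x) * M := by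
              rw [add_mul]
              exact le_add_left (by ring_nf; exact le_rfl)
          _ ≤ i * (D ^ u.length * D) := h
          _ = i * D * D ^ u.length := by ring
      refine ⟨hle, ?_⟩
      rw [Nat.sub_mul]
      refine Nat.le_sub_of_add_le ?_
      calc _ = (value .leastFirst u + D ^ u.length * x) * M := by ring
        _ ≤ _ := h
        _ = _ := by ring
    · rintro ⟨hle, h⟩
      rw [Nat.sub_mul] at h
      have h' := Nat.add_le_of_le_sub (Nat.mul_le_mul_right _ hle) h
      calc _ = value .leastFirst u * M + x * M * D ^ u.length := by ring
        _ ≤ _ := h'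
        _ = _ := by ring
  refine ⟨?_, Set.ext fun i => ?_, Set.ext fun i => ?_⟩
  · rw [List.length_append, List.length_append, Nat.add_mod, h₁, ← Nat.add_mod]
  · rw [Set.mem_ofPred_eq, Set.mem_ofPred_eq, lower, lower]
    exact Set.ext_iff.1 h₂ (i * D - x * M)
  · rw [Set.mem_ofPred_eq, Set.mem_ofPred_eq, upper, upper]
    exact and_congr_right fun _ => Set.ext_iff.1 h₃ (i * D - x * M)

/-- Remove the zeros at the end. -/
def strip {D : ℕ} (u : List (Fin D)) : List (Fin D) := u.rdropWhile fun x => x.val = 0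

theorem automatic_cell_strip (D M : ℕ) {t : ℕ} (ht : 0 < t) :
    Automatic fun u : List (Fin D) => (cell M t (strip u), cell M t u) := by
  refine automatic_of_congruence
    (((finite_range_cell D M ht).prod (finite_range_cell D M ht)).subset ?_) ?_
  · rintro _ ⟨u, rfl⟩
    exact ⟨⟨_, rfl⟩, ⟨_, rfl⟩⟩
  · intro u u' x h
    simp only [Prod.mk.injEq] at h ⊢
    refine ⟨?_, cell_concat x h.2⟩
    simp only [strip, List.rdropWhile_concat]
    split_ifs
    · exact h.1
    · exact cell_concat x h.2

theorem value_strip {D : ℕ} (u : List (Fin D)) :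
    value .leastFirst (strip u) = value .leastFirst u := by
  induction u using List.reverseRecOn with
  | nil => rfl
  | append_singleton u x ih =>
    unfold strip at ih ⊢
    rw [List.rdropWhile_concat]
    split_ifs with hx
    · rw [ih, value_concat]
      simp_all
    · rfl

theorem pow_length_strip_le {D : ℕ} (u : List (Fin D)) (h : 0 < value .leastFirst u) :
    D ^ (strip u).length ≤ D * value .leastFirst u := by
  induction u using List.reverseRecOn with
  | nil => simp [value] at h
  | append_singleton u x ih =>
    unfold strip at ih ⊢
    rw [List.rdropWhile_concat]
    rw [value_concat] at h ⊢
    split_ifs with hx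
    · have hx : x.val = 0 := by simpa using hx
      simp only [hx, mul_zero, add_zero] at h ⊢
      exact ih h
    · have hx : 1 ≤ x.val := Nat.one_le_iff_ne_zero.2 (by simpa using hx)
      rw [List.length_append, List.length_singleton, pow_succ, mul_comm]
      exact Nat.mul_le_mul_left D (le_add_left (Nat.le_mul_of_pos_right _ hx))

end Automatic

section FiniteSolvable

theorem Commensurable.exists_pow_eq {d D : ℕ} (hd : 2 ≤ d) (hD : 2 ≤ D)
    (h : Commensurable d D) : ∃ (t : ℕ) (s : ℤ), 0 < t ∧ (D : ℝ) ^ t = (d : ℝ) ^ s := by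
  have hd1 : (1 : ℝ) < d := by exact_mod_cast (by omega : 1 < d)
  have hD0 : (0 : ℝ) < D := by exact_mod_cast (by omega : 0 < D)
  unfold Commensurable Irrational at h
  push Not at h
  obtain ⟨x, hx⟩ := h
  refine ⟨x.den, x.num, x.den_pos, ?_⟩
  have hDx : (D : ℝ) = (d : ℝ) ^ (x : ℝ) := by
    rw [hx, Real.rpow_logb (by linarith) hd1.ne' hD0]
  rw [hDx, ← Real.rpow_natCast, ← Real.rpow_mul (by linarith), ← Real.rpow_intCast]
  congr 1
  exact_mod_cast Rat.mul_den_eq_num x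

/-- The denominator of a grid fine enough to determine significands. -/
def grid (d D n t : ℕ) : ℕ := 2 * d * d ^ (n + D) * D ^ t

theorem isBestSignificand_of_same_cell {d D n t j m : ℕ} (hd : 2 ≤ d) (hD : 2 ≤ D)
    (hj : j ≤ t) {y y' : ℝ} (hy : 1 ≤ D * y)
    (hl : ∀ i : ℕ, (i : ℝ) ≤ y * grid d D n t → (i : ℝ) ≤ y' * grid d D n t)
    (hu : ∀ i : ℕ, y * grid d D n t ≤ i → y' * grid d D n t ≤ i)
    (h : IsBestSignificand d n (y * (D : ℝ) ^ j) m) :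
    IsBestSignificand d n (y' * (D : ℝ) ^ j) m := by
  have hd1 : (1 : ℝ) < d := by exact_mod_cast (by omega : 1 < d)
  have hd0 : (0 : ℝ) < d := by linarith
  have hD1 : (1 : ℝ) ≤ D := by exact_mod_cast (by omega : 1 ≤ D)
  have hD0 : (0 : ℝ) < D := by linarith
  rw [isBestSignificand_iff hd] at h ⊢
  obtain ⟨h₁, h₂, q, hql, hqu⟩ := h
  refine ⟨h₁, h₂, q, ?_⟩
  have hq : -((n + D : ℕ) : ℤ) ≤ q := by
    by_contra! hcon
    have hup : (upperEnd d m : ℝ) ≤ 2 * d * (d : ℝ) ^ n := by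
      have : upperEnd d m ≤ 2 * d * d ^ n := by
        unfold upperEnd
        nlinarith [Nat.mul_le_mul_left (2 * d) h₂]
      exact_mod_cast this
    have hdq : (d : ℝ) ^ q ≤ (d : ℝ) ^ (-((n + D : ℕ) : ℤ)) :=
      zpow_le_zpow_right₀ hd1.le hcon.le
    have hDd : (D : ℝ) < (d : ℝ) ^ D := by exact_mod_cast Nat.lt_pow_self (by omega)
    have hyj : y ≤ y * (D : ℝ) ^ j := by
      have hy0 : 0 ≤ y := by
        by_contra! hneg
        nlinarith
      exact le_mul_of_one_le_right hy0 (one_le_pow₀ hD1)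
    have hchain : 2 * d * y ≤ 2 * d * ((d : ℝ) ^ D)⁻¹ := by
      calc 2 * d * y ≤ 2 * d * (y * (D : ℝ) ^ j) := by gcongr
        _ ≤ upperEnd d m * (d : ℝ) ^ q := hqu
        _ ≤ 2 * d * (d : ℝ) ^ n * (d : ℝ) ^ (-((n + D : ℕ) : ℤ)) := by gcongr
        _ = 2 * d * ((d : ℝ) ^ D)⁻¹ := by
          rw [zpow_neg, zpow_natCast, pow_add]
          field_simp
    have hy₂ : y ≤ ((d : ℝ) ^ D)⁻¹ := le_of_mul_le_mul_left hchain (by positivity)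
    have : (D : ℝ) * y ≤ D * ((d : ℝ) ^ D)⁻¹ := by gcongr
    have hlt : (D : ℝ) * ((d : ℝ) ^ D)⁻¹ < 1 := by
      rw [← div_eq_mul_inv, div_lt_one (by positivity)]
      exact hDd
    linarith
  obtain ⟨p, hp⟩ : ∃ p : ℕ, q = p - ((n + D : ℕ) : ℤ) := ⟨(q + (n + D : ℕ)).toNat, by omega⟩
  have hdq : (d : ℝ) ^ q * (d : ℝ) ^ (n + D) = (d : ℝ) ^ p := by
    rw [hp, zpow_sub₀ hd0.ne', zpow_natCast, zpow_natCast]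
    field_simp
  have hDj : (D : ℝ) ^ j * (D : ℝ) ^ (t - j) = (D : ℝ) ^ t := by
    rw [← pow_add, Nat.add_sub_cancel' hj]
  set c : ℝ := (d : ℝ) ^ (n + D) * (D : ℝ) ^ (t - j) with hc
  have hc0 : 0 < c := by positivity
  have scaleGrid (z : ℝ) : 2 * d * (z * (D : ℝ) ^ j) * c = z * grid d D n t := by
    unfold grid
    push_cast
    rw [← hDj, hc]
    ring
  have scaleEnd (a : ℕ) : (a : ℝ) * (d : ℝ) ^ q * c = ((a * d ^ p * D ^ (t - j) : ℕ) : ℝ) := by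
    push_cast
    rw [← hdq, hc]
    ring
  rw [← mul_le_mul_iff_left₀ hc0, scaleGrid, scaleEnd] at hql hqu
  refine ⟨?_, ?_⟩ <;> rw [← mul_le_mul_iff_left₀ hc0, scaleGrid, scaleEnd]
  · exact hl _ hql
  · exact hu _ hqu

/-- The significand depends only on the cell of the digits without leading zeros and on the
residue of the exponent. -/
theorem isBestSignificand_of_cell_eq {d D n t m : ℕ} {s e e' : ℤ} (hd : 2 ≤ d) (hD : 2 ≤ D)
    (ht : 0 < t) (hs : (D : ℝ) ^ t = (d : ℝ) ^ s) {u u' : List (Fin D)}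
    (hu : 0 < value .leastFirst u)
    (hcell : cell (grid d D n t) t (strip u) = cell (grid d D n t) t (strip u'))
    (he : e ≡ e' [ZMOD t])
    (h : IsBestSignificand d n ((value .leastFirst u : ℝ) * (D : ℝ) ^ e) m) :
    IsBestSignificand d n ((value .leastFirst u' : ℝ) * (D : ℝ) ^ e') m := by
  have hD0 : (0 : ℝ) < D := by exact_mod_cast (by omega : 0 < D)
  have ht' : (0 : ℤ) < t := by exact_mod_cast ht
  simp only [cell, Prod.mk.injEq, value_strip] at hcell
  obtain ⟨hlen, hlow, hupp⟩ := hcell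
  have hlarge := pow_length_strip_le u hu
  set k := (strip u).length
  set k' := (strip u').length
  have hres : (k + e) % t = (k' + e') % t := by
    have hk : (k : ℤ) ≡ k' [ZMOD t] := (Int.natCast_modEq_iff).2 hlen
    exact hk.add he
  obtain ⟨j, hj⟩ : ∃ j : ℕ, (k + e) % t = j := ⟨((k + e) % t).toNat, by
    have := Int.emod_nonneg (k + e) ht'.ne'
    omega⟩
  have hjt : j ≤ t := by
    have := Int.emod_lt_of_pos (k + e) ht'
    omega
  have split (f k : ℕ) (e : ℤ) (hj : (k + e) % t = j) : (f : ℝ) * (D : ℝ) ^ e =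
      (f : ℝ) / (D : ℝ) ^ k * (D : ℝ) ^ j * (d : ℝ) ^ (s * ((k + e) / t)) := by
    have hdecomp : e = -(k : ℤ) + (j : ℤ) + t * ((k + e) / t) := by
      have := Int.emod_add_mul_ediv (k + e) t
      rw [hj] at this
      linarith
    rw [zpow_mul, ← hs, ← zpow_natCast (D : ℝ) t, ← zpow_mul]
    conv_lhs => rw [hdecomp, zpow_add₀ hD0.ne', zpow_add₀ hD0.ne', zpow_neg]
    rw [zpow_natCast, zpow_natCast]
    ring
  rw [split _ k e hj, isBestSignificand_mul_zpow hd] at h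
  rw [split _ k' e' (hres ▸ hj), isBestSignificand_mul_zpow hd]
  have lowIff (f k i : ℕ) : (i : ℝ) ≤ (f : ℝ) / (D : ℝ) ^ k * grid d D n t ↔
      i * D ^ k ≤ f * grid d D n t := by
    rw [div_mul_eq_mul_div, le_div_iff₀ (by positivity)]
    exact_mod_cast Iff.rfl
  have uppIff (f k i : ℕ) : (f : ℝ) / (D : ℝ) ^ k * grid d D n t ≤ i ↔
      f * grid d D n t ≤ i * D ^ k := by
    rw [div_mul_eq_mul_div, div_le_iff₀ (by positivity)]
    exact_mod_cast Iff.rfl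
  refine isBestSignificand_of_same_cell hd hD hjt ?_ (fun i => ?_) (fun i => ?_) h
  · rw [← mul_div_assoc, one_le_div (by positivity)]
    exact_mod_cast hlarge
  · rw [lowIff, lowIff]
    exact (Set.ext_iff.1 hlow i).1
  · rw [uppIff, uppIff]
    exact (Set.ext_iff.1 hupp i).1

theorem signed_modEq {t k k' : ℕ} (neg : Bool) (h : k ≡ k' [MOD t]) :
    signed neg k ≡ signed neg k' [ZMOD t] := by
  have := Int.natCast_modEq_iff.2 h
  cases neg
  · exact this
  · exact this.neg

/-- The automaton that runs one automaton on the digits of `f`, another one on the digits of the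
exponent, and remembers the sign. -/
def productDFA {D b : ℕ} {Q₁ Q₂ : Type} (δ₁ : Q₁ → Fin D → Q₁) (p₁ : Q₁) (δ₂ : Q₂ → Fin b → Q₂)
    (p₂ : Q₂) : DFA (Letter D b) (Q₁ × Option Bool × Q₂) where
  step q a := match a with
    | .sig x => (δ₁ q.1 x, q.2)
    | .plus => (q.1, some false, q.2.2)
    | .minus => (q.1, some true, q.2.2)
    | .exp x => (q.1, q.2.1, δ₂ q.2.2 x)
    | .endMark => q
  start := (p₁, none, p₂)
  accept := Set.univ

theorem productDFA_eval {D b : ℕ} {Q₁ Q₂ : Type} (δ₁ : Q₁ → Fin D → Q₁) (p₁ : Q₁)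
    (δ₂ : Q₂ → Fin b → Q₂) (p₂ : Q₂) (u : List (Fin D)) (neg : Bool) (v : List (Fin b)) :
    (productDFA δ₁ p₁ δ₂ p₂).eval (encode u neg v) =
      (u.foldl δ₁ p₁, some neg, v.foldl δ₂ p₂) := by
  have h₁ : ∀ (u : List (Fin D)) (p : Q₁), List.foldl (productDFA δ₁ p₁ δ₂ p₂).step
      (p, none, p₂) (u.map .sig) = (u.foldl δ₁ p, none, p₂) := by
    intro u
    induction u with
    | nil => exact fun p => rfl
    | cons x u ih => exact fun p => ih (δ₁ p x)
  have h₂ : ∀ (v : List (Fin b)) (p : Q₁) (q : Q₂), List.foldl (productDFA δ₁ p₁ δ₂ p₂).step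
      (p, some neg, q) (v.map .exp) = (p, some neg, v.foldl δ₂ q) := by
    intro v
    induction v with
    | nil => exact fun p q => rfl
    | cons x v ih => exact fun p q => ih p (δ₂ q x)
  have h₃ (p : Q₁) : (productDFA δ₁ p₁ δ₂ p₂).step (p, none, p₂)
      (if neg then .minus else .plus) = (p, some neg, p₂) := by
    cases neg <;> rfl
  unfold encode DFA.eval DFA.evalFrom
  rw [List.foldl_append, show (productDFA δ₁ p₁ δ₂ p₂).start = (p₁, none, p₂) from rfl, h₁,
    List.foldl_cons, h₃, List.foldl_append, h₂]
  rfl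

theorem Commensurable.solvableByDFA {d D b n : ℕ} (hd : 2 ≤ d) (hD : 2 ≤ D) (hn : 1 ≤ n)
    (h : Commensurable d D) (ordF ordE : DigitOrder) (tie : TieRule) :
    SolvableByDFA (clingerProblem d D b n ordF ordE tie) := by
  obtain ⟨t, s, ht, hs⟩ := h.exists_pow_eq hd hD
  have hD0 : (0 : ℝ) < D := by exact_mod_cast (by omega : 0 < D)
  obtain ⟨Q₁, _, δ₁, p₁, h₁⟩ :=
    (automatic_cell_strip D (grid d D n t) ht).comp_leastFirstDigits ordF
  obtain ⟨Q₂, _, δ₂, p₂, h₂⟩ := (automatic_value_mod b ht).comp_leastFirstDigits ordE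
  let number (u : List (Fin D)) (neg : Bool) (v : List (Fin b)) : ℝ :=
    (value ordF u : ℝ) * (D : ℝ) ^ signed neg (value ordE v)
  have hsame : ∀ u u' neg v v', 0 < value ordF u → 0 < value ordF u' →
      u.foldl δ₁ p₁ = u'.foldl δ₁ p₁ → v.foldl δ₂ p₂ = v'.foldl δ₂ p₂ →
      {m | IsSignificand tie d n (number u neg v) m} =
        {m | IsSignificand tie d n (number u' neg v') m} := by
    intro u u' neg v v' hu hu' heu hev
    have hcell := congrArg Prod.fst (h₁ _ _ heu)
    have hmod : _ ≡ _ [MOD t] := congrArg Prod.fst (h₂ _ _ hev)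
    have he := signed_modEq neg hmod
    simp only [number]
    rw [value_eq_value_leastFirst] at hu hu'
    simp only [value_eq_value_leastFirst ordF, value_eq_value_leastFirst ordE]
    exact setOf_isSignificand_congr tie fun m =>
      ⟨isBestSignificand_of_cell_eq hd hD ht hs hu hcell he,
        isBestSignificand_of_cell_eq hd hD ht hs hu' hcell.symm he.symm⟩
  have hout : ∀ q : Q₁ × Option Bool × Q₂, ∃ m, ∀ (u : List (Fin D)) (neg : Bool)
      (v : List (Fin b)), 0 < value ordF u →
      q = (u.foldl δ₁ p₁, some neg, v.foldl δ₂ p₂) →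
        IsSignificand tie d n (number u neg v) m := by
    intro q
    by_cases hq : ∃ (u : List (Fin D)) (neg : Bool) (v : List (Fin b)), 0 < value ordF u ∧
        q = (u.foldl δ₁ p₁, some neg, v.foldl δ₂ p₂)
    · obtain ⟨u, neg, v, hu, rfl⟩ := hq
      have hpos : 0 < number u neg v :=
        mul_pos (by exact_mod_cast hu) (zpow_pos hD0 _)
      obtain ⟨m, hm⟩ := exists_isSignificand tie hd hn hpos
      refine ⟨m, fun u' neg' v' hu' he => ?_⟩
      simp only [Prod.mk.injEq, Option.some.injEq] at he
      obtain ⟨heu, rfl, hev⟩ := he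
      exact (Set.ext_iff.1 (hsame u u' neg v v' hu hu' heu hev) m).1 hm
    · exact ⟨0, fun u neg v hu he => absurd ⟨u, neg, v, hu, he⟩ hq⟩
  choose out hout using hout
  refine ⟨Q₁ × Option Bool × Q₂, inferInstance, productDFA δ₁ p₁ δ₂ p₂, out, ?_⟩
  rintro w S ⟨u, neg, v, hu, he⟩
  obtain ⟨rfl, rfl⟩ := Prod.mk.inj he
  exact ⟨trivial, hout _ u neg v hu (productDFA_eval δ₁ p₁ δ₂ p₂ u neg v)⟩

end FiniteSolvable

end Clinger

theorem mainTheorem2 (d D b n : ℕ) (hd : 2 ≤ d) (hD : 2 ≤ D) (hb : 2 ≤ b) (hn : 1 ≤ n)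
    (hdn : 2 < d ∨ 1 < n) (ordF ordE : Clinger.DigitOrder) (tie : Clinger.TieRule) :
    (Clinger.SolvableByPDA (Clinger.clingerProblem d D b n ordF ordE tie) ↔
      Clinger.Commensurable d D) ∧
    (Clinger.SolvableByDFA (Clinger.clingerProblem d D b n ordF ordE tie) ↔
      Clinger.Commensurable d D) :=
  ⟨⟨Clinger.commensurable_of_solvableByPDA hd hD hdn,
      fun h => (h.solvableByDFA hd hD hn ordF ordE tie).solvableByPDA⟩,
    ⟨fun h => Clinger.commensurable_of_solvableByPDA hd hD hdn h.solvableByPDA,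
      fun h => h.solvableByDFA hd hD hn ordF ordE tie⟩⟩
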